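/- Let $\eta>0$. For $b>0$ let $\mathrm{Lap}(b)$ be the law on $\mathbb R$ with density $x\mapsto \frac1{2b}e^{-|x|/b}$, and write $\mathrm{Lap}(b)^{\otimes d}$ for the law on $\mathbb R^d$ with independent $\mathrm{Lap}(b)$ coordinates. Let $(P_t)_{t\ge\eta}$ be an inhomogeneous Poisson process with $P_\eta=0$ and intensity function $\lambda(t)=2/t$. Put $\mathcal T_0:=\eta$ and $\mathcal T_n:=\inf\{t\ge\eta: P_t\ge n\}$ for $n\ge1$. Let $X_0,X_1,\dots$ be real random variables which, conditionally on $(P_t)_{t\ge\eta}$, are independent with $X_n\sim\mathrm{Lap}(\mathcal T_n)$, and set $$Z_t:=\sum_{n=0}^{P_t}X_n\qquad(t\ge\eta).$$ **Theorem.** 1. For every $t\ge\eta$, $Z_t\sim\mathrm{Lap}(t)$. 2. The process $(Z_t)_{t\ge\eta}$ is a continuous-time extension of the Laplace process of Koufogiannis et al.: for all $K\ge0$ and $\eta\le t_1\le\dots\le t_K$, the vector $(Z_{t_1},\dots,Z_{t_K})$ has the same law as $(\zeta_1,\dots,\zeta_K)$, where $t_0:=0$, $\zeta_0:=0$ and,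 independently of the past, $$\zeta_k=\begin{cases}\zeta_{k-1}&\text{with probability }(t_{k-1}/t_k)^2,\\ \zeta_{k-1}+\mathrm{Lap}(t_k)&\text{otherwise.}\end{cases}$$ 3. The same holds in dimension $d$: if $(P^{(j)},X^{(j)})$, $j=1,\dots,d$, are independent pairs as above and $Z^{(1)},\dots,Z^{(d)}$ are the corresponding processes, then $(Z^{(1)}_t,\dots,Z^{(d)}_t)\sim\mathrm{Lap}(t)^{\otimes d}$ for every $t\ge\eta$, and for $\eta\le t_1\le\dots\le t_K$ the family $(Z^{(j)}_{t_k})_{j\le d,\,k\le K}$ has the law of $d$ independent copies of $(\zeta_1,\dots,\zeta_K)$. -/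

import Mathlib

open MeasureTheory ProbabilityTheory Set
open scoped ENNReal NNReal

noncomputable section

namespace LaplaceNoise

/-- The centred Laplace distribution `Lap(b)` on `ℝ` with scale `b > 0`, i.e. the law with density
`x ↦ exp (-|x| / b) / (2 b)`. -/
def laplaceMeasure (b : ℝ) : Measure ℝ :=
  volume.withDensity fun x => ENNReal.ofReal (Real.exp (-|x| / b) / (2 * b))

variable {Ω : Type*} [MeasurableSpace Ω]

/-- `P` is an inhomogeneous Poisson process on `[η, ∞)` with intensity function `lam`: it starts
at `0` at time `η`, has independent increments, `P t - P s` is Poisson with mean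
`∫ u in s..t, lam u` for `s ≤ t`, and almost every path is nondecreasing and right-continuous. -/
structure IsPoissonProcess (μ : Measure Ω) (η : ℝ) (lam : ℝ → ℝ) (P : Ici η → Ω → ℕ) : Prop where
  measurable : ∀ t, Measurable (P t)
  start : ∀ᵐ ω ∂μ, P ⟨η, self_mem_Ici⟩ ω = 0
  indep : HasIndepIncrements P μ
  law : ∀ s t : Ici η, s ≤ t →
    HasLaw (fun ω => P t ω - P s ω) (poissonMeasure (∫ u in (s : ℝ)..t, lam u).toNNReal) μ
  mono : ∀ᵐ ω ∂μ, Monotone fun t => P t ω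
  rightCts : ∀ᵐ ω ∂μ, ∀ t : Ici η, ContinuousWithinAt (fun s => P s ω) (Ici t) t

/-- The jump times: `𝒯₀ = η` and `𝒯ₙ = inf {t ≥ η : P t ≥ n}` for `n ≥ 1`. -/
def jumpTime {η : ℝ} (P : Ici η → Ω → ℕ) : ℕ → Ω → ℝ
  | 0, _ => η
  | n + 1, ω => sInf {t : ℝ | ∃ h : η ≤ t, n + 1 ≤ P ⟨t, h⟩ ω}

/-- The σ-algebra generated by the whole process `P`. -/
abbrev processSigma {η : ℝ} (P : Ici η → Ω → ℕ) : MeasurableSpace Ω :=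
  ⨆ t, MeasurableSpace.comap (P t) ⊤

/-- `X 0, X 1, …` are "independent `Lap(𝒯ₙ)` variables": conditionally on the process `P`, they are
independent and `X n` has law `Lap(𝒯ₙ)`. Conditioning is spelled out by integrating over the events
`A` of the σ-algebra generated by `P`. -/
structure IsLaplaceJumps (μ : Measure Ω) {η : ℝ} (P : Ici η → Ω → ℕ) (X : ℕ → Ω → ℝ) : Prop where
  measurable : ∀ n, Measurable (X n)
  condLaw : ∀ A : Set Ω, MeasurableSet[processSigma P] A →
    ∀ (N : ℕ) (B : ℕ → Set ℝ), (∀ n, MeasurableSet (B n)) →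
      μ (A ∩ ⋂ n ∈ Finset.range N, X n ⁻¹' B n) =
        ∫⁻ ω in A, ∏ n ∈ Finset.range N, laplaceMeasure (jumpTime P n ω) (B n) ∂μ

/-- The process `Z t = ∑_{n = 0}^{P t} X n`. -/
def laplaceProcess {η : ℝ} (P : Ici η → Ω → ℕ) (X : ℕ → Ω → ℝ) (t : Ici η) (ω : Ω) : ℝ :=
  ∑ n ∈ Finset.range (P t ω + 1), X n ω

/-- The law of a coin showing `true` with probability `p ∈ [0, 1]`. -/
def coin (p : ℝ) : Measure Bool :=
  ENNReal.ofReal p • Measure.dirac true + ENNReal.ofReal (1 - p) • Measure.dirac false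

/-- One path of the discrete process driven by coins and noises `x k = (c k, l k)`: `ζ 0 = 0`, and
`ζ (k + 1) = ζ k` if the coin `c k` shows `true`, `ζ (k + 1) = ζ k + l k` otherwise. -/
def discretePath {K : ℕ} (x : Fin K → Bool × ℝ) : Fin (K + 1) → ℝ :=
  Fin.induction 0 fun k z => if (x k).1 then z else z + (x k).2

/-- The law of `(ζ₁, …, ζ_K)` for the discrete Laplace process with times `t₁ ≤ … ≤ t_K`
(and `t₀ = 0`): `ζ₀ = 0`, and independently of the past `ζₖ = ζₖ₋₁` with probability
`(tₖ₋₁ / tₖ) ^ 2` and `ζₖ = ζₖ₋₁ + Lap(tₖ)` otherwise. The `k`-th coordinate (from `0`) of the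
family `t` is the time `t_{k + 1}`. -/
def discreteLaplaceLaw {K : ℕ} (t : Fin K → ℝ) : Measure (Fin K → ℝ) :=
  (Measure.pi fun k : Fin K =>
      (coin (((Fin.cons 0 t : Fin (K + 1) → ℝ) k.castSucc / t k) ^ 2)).prod
        (laplaceMeasure (t k))).map
    fun x k => discretePath x k.succ

end LaplaceNoise

end

namespace LaplaceNoise

/-- The characteristic function `v ↦ 1 / (1 + b² v²)` of `Lap(b)`. -/
noncomputable def lapFactor (v b : ℝ) : ℝ := (1 + b ^ 2 * v ^ 2)⁻¹

lemma lapFactor_pos (v b : ℝ) : 0 < lapFactor v b := by unfold lapFactor; positivity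

lemma lapFactor_le_one (v b : ℝ) : lapFactor v b ≤ 1 :=
  inv_le_one_of_one_le₀ (by nlinarith [sq_nonneg (b * v)])

lemma lapFactor_anti (v : ℝ) {a b : ℝ} (ha : 0 ≤ a) (hab : a ≤ b) :
    lapFactor v b ≤ lapFactor v a := by
  unfold lapFactor
  gcongr

@[fun_prop]
lemma measurable_lapFactor (v : ℝ) : Measurable (lapFactor v) := by
  unfold lapFactor; fun_prop

/-! ### The Laplace distribution -/

lemma integrable_laplace_density {b : ℝ} (hb : 0 < b) :
    Integrable fun x : ℝ => Real.exp (-|x| / b) / (2 * b) := by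
  refine Integrable.div_const ?_ _
  rw [← integrableOn_univ, ← Iic_union_Ioi (a := (0 : ℝ))]
  refine IntegrableOn.union ?_ ?_
  · refine (integrableOn_exp_mul_Iic (a := b⁻¹) (by simpa using hb) 0).congr_fun (fun x hx => ?_)
      measurableSet_Iic
    simp only [abs_of_nonpos (mem_Iic.1 hx)]
    congr 1; ring
  · refine (integrableOn_exp_mul_Ioi (a := -b⁻¹) (by simpa using hb) 0).congr_fun (fun x hx => ?_)
      measurableSet_Ioi
    simp only [abs_of_pos (mem_Ioi.1 hx)]
    congr 1; ring

lemma integral_laplace_mul_cexp {b : ℝ} (hb : 0 < b) (v : ℝ) :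
    ∫ x : ℝ, ((Real.exp (-|x| / b) / (2 * b) : ℝ) : ℂ) * Complex.exp (v * x * Complex.I)
      = (lapFactor v b : ℝ) := by
  have hint : Integrable fun x : ℝ =>
      ((Real.exp (-|x| / b) / (2 * b) : ℝ) : ℂ) * Complex.exp (v * x * Complex.I) := by
    refine (integrable_laplace_density hb).ofReal.mul_bdd (c := 1) (by fun_prop)
      (.of_forall fun x => ?_)
    rw [← Complex.ofReal_mul, Complex.norm_exp_ofReal_mul_I]
  rw [← intervalIntegral.integral_Iic_add_Ioi (b := 0) hint.integrableOn hint.integrableOn]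
  have h1 : ∫ x in Iic (0 : ℝ), ((Real.exp (-|x| / b) / (2 * b) : ℝ) : ℂ) *
      Complex.exp (v * x * Complex.I) =
      (2 * b : ℂ)⁻¹ * ((b : ℂ)⁻¹ + v * Complex.I)⁻¹ := by
    have : ∀ x ∈ Iic (0 : ℝ), ((Real.exp (-|x| / b) / (2 * b) : ℝ) : ℂ) *
        Complex.exp (v * x * Complex.I) =
        (2 * b : ℂ)⁻¹ * Complex.exp (((b : ℂ)⁻¹ + v * Complex.I) * x) := by
      intro x hx
      rw [abs_of_nonpos (mem_Iic.1 hx)]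
      push_cast
      rw [div_eq_inv_mul, mul_assoc, ← Complex.exp_add]
      congr 2; ring
    rw [setIntegral_congr_fun measurableSet_Iic this, integral_const_mul,
      integral_exp_mul_complex_Iic (by simpa using hb)]
    simp
  have h2 : ∫ x in Ioi (0 : ℝ), ((Real.exp (-|x| / b) / (2 * b) : ℝ) : ℂ) *
      Complex.exp (v * x * Complex.I) =
      (2 * b : ℂ)⁻¹ * ((b : ℂ)⁻¹ - v * Complex.I)⁻¹ := by
    have : ∀ x ∈ Ioi (0 : ℝ), ((Real.exp (-|x| / b) / (2 * b) : ℝ) : ℂ) *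
        Complex.exp (v * x * Complex.I) =
        (2 * b : ℂ)⁻¹ * Complex.exp ((-(b : ℂ)⁻¹ + v * Complex.I) * x) := by
      intro x hx
      rw [abs_of_pos (mem_Ioi.1 hx)]
      push_cast
      rw [div_eq_inv_mul, mul_assoc, ← Complex.exp_add]
      congr 2; ring
    rw [setIntegral_congr_fun measurableSet_Ioi this, integral_const_mul,
      integral_exp_mul_complex_Ioi (by simpa using hb)]
    simp only [Complex.ofReal_zero, mul_zero, Complex.exp_zero, neg_div, one_div, ← inv_neg]
    congr 2; ring
  have hb' : (b : ℂ) ≠ 0 := by exact_mod_cast hb.ne'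
  have e1 : (b : ℂ)⁻¹ + v * Complex.I ≠ 0 := fun h => by
    simpa [hb.ne'] using congrArg Complex.re h
  have e2 : (b : ℂ)⁻¹ - v * Complex.I ≠ 0 := fun h => by
    simpa [hb.ne'] using congrArg Complex.re h
  have e3 : (1 + b ^ 2 * v ^ 2 : ℂ) ≠ 0 := by
    have : (1 + b ^ 2 * v ^ 2 : ℝ) ≠ 0 := by positivity
    exact_mod_cast this
  have e4 : ((b : ℂ)⁻¹ + v * Complex.I) * ((b : ℂ)⁻¹ - v * Complex.I) =
      (b : ℂ)⁻¹ ^ 2 * (1 + b ^ 2 * v ^ 2) := by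
    field_simp
    linear_combination (- v ^ 2 * b ^ 2 : ℂ) * Complex.I_sq
  rw [h1, h2, ← mul_add, inv_add_inv e1 e2, e4, lapFactor]
  push_cast
  field_simp
  ring

lemma charFun_laplaceMeasure {b : ℝ} (hb : 0 < b) (v : ℝ) :
    charFun (laplaceMeasure b) v = (lapFactor v b : ℝ) := by
  rw [charFun_apply_real, laplaceMeasure,
    integral_withDensity_eq_integral_toReal_smul (by fun_prop) (by simp)]
  rw [← integral_laplace_mul_cexp hb]
  refine integral_congr_ae (.of_forall fun x => ?_)
  simp only []
  rw [ENNReal.toReal_ofReal (by positivity), Complex.real_smul]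

lemma isProbabilityMeasure_laplaceMeasure {b : ℝ} (hb : 0 < b) :
    IsProbabilityMeasure (laplaceMeasure b) := by
  have : IsFiniteMeasure (laplaceMeasure b) :=
    isFiniteMeasure_withDensity_ofReal (integrable_laplace_density hb).2
  have h := charFun_laplaceMeasure hb 0
  rw [charFun_zero] at h
  rw [isProbabilityMeasure_iff_real]
  simpa [lapFactor] using h

lemma map_mul_laplaceMeasure_one {b : ℝ} (hb : 0 < b) :
    (laplaceMeasure 1).map (fun y => b * y) = laplaceMeasure b := by
  have := isProbabilityMeasure_laplaceMeasure hb
  have := isProbabilityMeasure_laplaceMeasure one_pos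
  have : IsProbabilityMeasure ((laplaceMeasure 1).map (fun y => b * y)) :=
    Measure.isProbabilityMeasure_map (by fun_prop)
  refine Measure.ext_of_charFun (funext fun v => ?_)
  rw [charFun_map_mul, charFun_laplaceMeasure one_pos, charFun_laplaceMeasure hb]
  simp only [lapFactor]
  congr 2; ring

/-! ### The increments of the discrete process -/

/-- The law of `0` with probability `(s / t)²` and of a `Lap(t)` variable otherwise. -/
noncomputable def incrLaw (s t : ℝ) : Measure ℝ :=
  ((coin ((s / t) ^ 2)).prod (laplaceMeasure t)).map fun x => if x.1 then 0 else x.2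

lemma isProbabilityMeasure_coin {p : ℝ} (h0 : 0 ≤ p) (h1 : p ≤ 1) :
    IsProbabilityMeasure (coin p) := by
  constructor
  simp only [coin, Measure.coe_add, Measure.coe_smul, Pi.add_apply, Pi.smul_apply, measure_univ,
    smul_eq_mul, mul_one]
  rw [← ENNReal.ofReal_add h0 (by linarith)]
  simp

lemma measurable_coinStep : Measurable fun x : Bool × ℝ => if x.1 then (0 : ℝ) else x.2 :=
  Measurable.ite (measurable_fst (measurableSet_singleton true)) measurable_const measurable_snd

lemma coin_prob {s t : ℝ} (hs : 0 ≤ s) (hst : s ≤ t) (ht : 0 < t) :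
    IsProbabilityMeasure (coin ((s / t) ^ 2)) := by
  refine isProbabilityMeasure_coin (by positivity) ?_
  exact pow_le_one₀ (by positivity) ((div_le_one ht).2 hst)

lemma isProbabilityMeasure_incrLaw {s t : ℝ} (hs : 0 ≤ s) (hst : s ≤ t) (ht : 0 < t) :
    IsProbabilityMeasure (incrLaw s t) := by
  have := coin_prob hs hst ht
  have := isProbabilityMeasure_laplaceMeasure ht
  exact Measure.isProbabilityMeasure_map measurable_coinStep.aemeasurable

lemma charFun_incrLaw {s t : ℝ} (hs : 0 ≤ s) (hst : s ≤ t) (ht : 0 < t) (v : ℝ) :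
    charFun (incrLaw s t) v = (lapFactor v t / lapFactor v s : ℝ) := by
  have := coin_prob hs hst ht
  have := isProbabilityMeasure_laplaceMeasure ht
  have hp : (s / t) ^ 2 ≤ 1 := pow_le_one₀ (by positivity) ((div_le_one ht).2 hst)
  have hm : Measurable fun x : ℝ => Complex.exp (v * x * Complex.I) := by fun_prop
  rw [charFun_apply_real, incrLaw, integral_map measurable_coinStep.aemeasurable
    hm.aestronglyMeasurable, integral_prod]
  · have h2 : ∫ x, Complex.exp (v * x * Complex.I) ∂(laplaceMeasure t) = (lapFactor v t : ℝ) := by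
      rw [← charFun_apply_real, charFun_laplaceMeasure ht]
    rw [coin, integral_add_measure (Integrable.of_finite.smul_measure ENNReal.ofReal_ne_top)
      (Integrable.of_finite.smul_measure ENNReal.ofReal_ne_top), integral_smul_measure,
      integral_smul_measure, integral_dirac, integral_dirac]
    simp only [↓reduceIte, Bool.false_eq_true, h2, Complex.ofReal_zero, mul_zero, zero_mul,
      Complex.exp_zero, integral_const, probReal_univ, one_smul]
    rw [ENNReal.toReal_ofReal (by positivity), ENNReal.toReal_ofReal (by linarith),
      Complex.real_smul, Complex.real_smul, mul_one, ← Complex.ofReal_mul, ← Complex.ofReal_add]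
    congr 1
    unfold lapFactor
    have : (1 + t ^ 2 * v ^ 2) ≠ 0 := by positivity
    field_simp
    ring
  · refine Integrable.of_bound (hm.comp measurable_coinStep).aestronglyMeasurable 1
      (.of_forall fun x => ?_)
    rw [← Complex.ofReal_mul, Complex.norm_exp_ofReal_mul_I]

/-! ### Partial sums -/

/-- The partial sums of a finite family. -/
noncomputable def stepSum {K : ℕ} (y : Fin K → ℝ) : Fin (K + 1) → ℝ := Fin.induction 0 fun k z => z + y k

lemma stepSum_succ {K : ℕ} (y : Fin K → ℝ) (k : Fin K) :
    stepSum y k.succ = stepSum y k.castSucc + y k := by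
  simp [stepSum]

lemma measurable_stepSum {K : ℕ} (k : Fin (K + 1)) :
    Measurable fun y : Fin K → ℝ => stepSum y k := by
  induction k using Fin.induction with
  | zero => simp [stepSum]
  | succ k ih => simp only [stepSum_succ]; fun_prop

lemma discretePath_eq_stepSum {K : ℕ} (x : Fin K → Bool × ℝ) (k : Fin (K + 1)) :
    discretePath x k = stepSum (fun i => if (x i).1 then 0 else (x i).2) k := by
  induction k using Fin.induction with
  | zero => simp [stepSum, discretePath]
  | succ k ih =>
    rw [stepSum_succ, ← ih]
    simp only [discretePath, Fin.induction_succ]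
    split_ifs <;> simp

lemma discreteLaplaceLaw_eq_map {K : ℕ} (s t : Fin K → ℝ)
    (hs : ∀ k : Fin K, (Fin.cons 0 t : Fin (K + 1) → ℝ) k.castSucc = s k)
    (h0 : ∀ k, 0 ≤ s k) (hst : ∀ k, s k ≤ t k) (ht : ∀ k, 0 < t k) :
    discreteLaplaceLaw t =
      (Measure.pi fun k => incrLaw (s k) (t k)).map fun y k => stepSum y k.succ := by
  have (k : Fin K) := isProbabilityMeasure_incrLaw (h0 k) (hst k) (ht k)
  have (k : Fin K) := coin_prob (h0 k) (hst k) (ht k)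
  have (k : Fin K) := isProbabilityMeasure_laplaceMeasure (ht k)
  simp only [incrLaw] at *
  have hm : Measurable fun (x : Fin K → Bool × ℝ) k => if (x k).1 then (0 : ℝ) else (x k).2 :=
    measurable_pi_lambda _ fun k => measurable_coinStep.comp (measurable_pi_apply k)
  rw [discreteLaplaceLaw, ← Measure.pi_map_pi fun k => measurable_coinStep.aemeasurable,
    Measure.map_map (measurable_pi_lambda _ fun k => measurable_stepSum _) hm]
  simp only [hs]
  congr 1
  funext x k
  exact discretePath_eq_stepSum x _

/-! ### Products over consecutive intervals -/

@[to_additive]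
lemma prod_range_prod_Ioc {M : Type*} [CommMonoid M] {p : ℕ → ℕ} (hp : Monotone p) (g : ℕ → M)
    (m : ℕ) :
    ∏ i ∈ Finset.range m, ∏ n ∈ Finset.Ioc (p i) (p (i + 1)), g n =
      ∏ n ∈ Finset.Ioc (p 0) (p m), g n := by
  induction m with
  | zero => simp
  | succ m ih =>
    rw [Finset.prod_range_succ, ih, Finset.prod_Ioc_consecutive g (hp m.zero_le) (hp m.le_succ)]

lemma exists_interval_index {p : ℕ → ℕ} (hp : Monotone p) :
    ∃ idx : ℕ → ℕ, ∀ k n, n ∈ Finset.Ioc (p k) (p (k + 1)) → idx n = k := by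
  classical
  refine ⟨fun n => if h : ∃ k, n ∈ Finset.Ioc (p k) (p (k + 1)) then h.choose else 0,
    fun k n hn => ?_⟩
  have h : ∃ k, n ∈ Finset.Ioc (p k) (p (k + 1)) := ⟨k, hn⟩
  refine (dif_pos h).trans ?_
  have h1 := Finset.mem_Ioc.1 h.choose_spec
  have h2 := Finset.mem_Ioc.1 hn
  by_contra hne
  rcases lt_or_gt_of_ne hne with hlt | hlt
  · have := hp (Nat.succ_le_of_lt hlt); simp only [Nat.succ_eq_add_one] at this; omega
  · have := hp (Nat.succ_le_of_lt hlt); simp only [Nat.succ_eq_add_one] at this; omega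

@[to_additive]
lemma prod_range_succ_eq_mul_prod_Ioc {M : Type*} [CommMonoid M] {p : ℕ → ℕ} (hp : Monotone p)
    (h0 : p 0 = 0) {idx : ℕ → ℕ} (hidx : ∀ k n, n ∈ Finset.Ioc (p k) (p (k + 1)) → idx n = k)
    (g : ℕ → ℕ → M) (K : ℕ) :
    ∏ n ∈ Finset.range (p K + 1), g (if n = 0 then 0 else idx n) n =
      g 0 0 * ∏ k ∈ Finset.range K, ∏ n ∈ Finset.Ioc (p k) (p (k + 1)), g k n := by
  have h1 : ∏ k ∈ Finset.range K, ∏ n ∈ Finset.Ioc (p k) (p (k + 1)), g k n =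
      ∏ k ∈ Finset.range K, ∏ n ∈ Finset.Ioc (p k) (p (k + 1)),
        g (if n = 0 then 0 else idx n) n := by
    refine Finset.prod_congr rfl fun k _ => Finset.prod_congr rfl fun n hn => ?_
    rw [hidx k n hn, if_neg]
    have := Finset.mem_Ioc.1 hn
    omega
  rw [h1, prod_range_prod_Ioc hp (fun n => g (if n = 0 then 0 else idx n) n) K, h0]
  have h2 : Finset.range (p K + 1) = insert 0 (Finset.Ioc 0 (p K)) := by
    ext n
    simp only [Finset.mem_range, Finset.mem_insert, Finset.mem_Ioc]
    omega
  rw [h2, Finset.prod_insert (by simp)]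
  simp

@[to_additive]
lemma prod_range_blocks {M : Type*} [CommMonoid M] (F : ℕ → M) (K m : ℕ) :
    ∏ j ∈ Finset.range (K * m), F j =
      ∏ k ∈ Finset.range K, ∏ r ∈ Finset.range m, F (k * m + r) := by
  induction K with
  | zero => simp
  | succ K ih => rw [Nat.succ_mul, Finset.prod_range_add, ih, Finset.prod_range_succ]

lemma prod_range_div_of_ne_zero {g : ℕ → ℝ} (hg : ∀ i, g i ≠ 0) (m : ℕ) :
    ∏ i ∈ Finset.range m, g (i + 1) / g i = g m / g 0 := by
  induction m with
  | zero => simp [hg 0]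
  | succ m ih =>
    rw [Finset.prod_range_succ, ih]
    have := hg m
    have := hg 0
    field_simp

/-! ### Comparison of the one-step factors -/

lemma exp_le_lapFactor_div {a b : ℝ} (v : ℝ) (ha : 0 < a) (hb : 0 < b) :
    Real.exp (-((1 - lapFactor v b) * (2 * Real.log (b / a)))) ≤ lapFactor v b / lapFactor v a := by
  set p := 1 - lapFactor v b with hp
  have h := convexOn_exp.2 (mem_univ 0) (mem_univ (-(2 * Real.log (b / a))))
    (lapFactor_pos v b).le (sub_nonneg.2 (lapFactor_le_one v b)) (by ring)
  have e : Real.exp (-(2 * Real.log (b / a))) = a ^ 2 / b ^ 2 := by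
    rw [Real.exp_neg, two_mul, Real.exp_add, Real.exp_log (by positivity)]
    field_simp
  simp only [smul_eq_mul, mul_zero, zero_add, Real.exp_zero, mul_one, e] at h
  rw [← mul_neg]
  refine h.trans_eq ?_
  unfold lapFactor
  have : (1 + b ^ 2 * v ^ 2) ≠ 0 := by positivity
  field_simp
  ring

lemma lapFactor_div_le_exp {a b : ℝ} (v : ℝ) (ha : 0 < a) (hb : 0 < b) :
    lapFactor v b / lapFactor v a ≤ Real.exp (-((1 - lapFactor v a) * (2 * Real.log (b / a)))) := by
  have h := exp_le_lapFactor_div v hb ha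
  have e : Real.log (a / b) = -Real.log (b / a) := by rw [← Real.log_inv, inv_div]
  rw [e] at h
  have h2 := inv_anti₀ (Real.exp_pos _) h
  rw [inv_div, ← Real.exp_neg] at h2
  refine h2.trans_eq ?_
  congr 1; ring

lemma lapFactor_sub_le {a b : ℝ} (v : ℝ) (ha : 0 < a) (hab : a ≤ b) :
    lapFactor v a - lapFactor v b ≤ 2 * Real.log (b / a) := by
  have hb : 0 < b := ha.trans_le hab
  have h1 : 1 - (a / b) ^ 2 ≤ 2 * Real.log (b / a) := by
    have := Real.one_sub_inv_le_log_of_pos (x := (b / a) ^ 2) (by positivity)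
    rw [Real.log_pow, ← inv_pow, inv_div] at this
    exact_mod_cast this
  refine le_trans ?_ h1
  have h2 : lapFactor v a - lapFactor v b =
      (1 - (a / b) ^ 2) * ((b ^ 2 * v ^ 2 * lapFactor v b) * lapFactor v a) := by
    unfold lapFactor
    have : (1 + b ^ 2 * v ^ 2) ≠ 0 := by positivity
    have : (1 + a ^ 2 * v ^ 2) ≠ 0 := by positivity
    field_simp
    ring
  rw [h2]
  have h3 : (a / b) ^ 2 ≤ 1 := pow_le_one₀ (by positivity) ((div_le_one hb).2 hab)
  have h4 : b ^ 2 * v ^ 2 * lapFactor v b ≤ 1 := by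
    unfold lapFactor
    rw [← div_eq_mul_inv, div_le_one (by positivity)]
    linarith
  have h5 : b ^ 2 * v ^ 2 * lapFactor v b * lapFactor v a ≤ 1 :=
    mul_le_one₀ h4 (lapFactor_pos v a).le (lapFactor_le_one v a)
  nlinarith

lemma exp_sum_sub_exp_sum_le {K : ℕ} {l u c : ℕ → ℝ} (hu : ∀ i, 0 ≤ u i) (hc0 : ∀ i, 0 ≤ c i)
    (h : ∀ i, l i - u i ≤ c i) :
    ∏ i ∈ Finset.range K, Real.exp (-u i) - ∏ i ∈ Finset.range K, Real.exp (-l i) ≤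
      ∑ i ∈ Finset.range K, c i := by
  rw [← Real.exp_sum, ← Real.exp_sum, Finset.sum_neg_distrib, Finset.sum_neg_distrib]
  set U := ∑ i ∈ Finset.range K, u i
  set V := ∑ i ∈ Finset.range K, l i
  have hU : 0 ≤ U := Finset.sum_nonneg fun i _ => hu i
  have hc : V - U ≤ ∑ i ∈ Finset.range K, c i := by
    rw [← Finset.sum_sub_distrib]
    exact Finset.sum_le_sum fun i _ => h i
  have e : Real.exp (-V) = Real.exp (-U) * Real.exp (-(V - U)) := by
    rw [← Real.exp_add]; congr 1; ring
  have h1 : Real.exp (-U) ≤ 1 := Real.exp_le_one_iff.2 (by linarith)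
  have h2 := Real.add_one_le_exp (-(V - U))
  have h3 := Real.exp_pos (-U)
  have h4 := Real.exp_pos (-V)
  rcases le_total 0 (V - U) with h5 | h5
  · nlinarith
  · have : Real.exp (-U) ≤ Real.exp (-V) := Real.exp_le_exp.2 (by linarith)
    have := Finset.sum_nonneg fun i (_ : i ∈ Finset.range K) => hc0 i
    linarith

variable {Ω : Type*} [MeasurableSpace Ω]

/-! ### Jump times -/

omit [MeasurableSpace Ω] in
lemma bddBelow_jumpSet {η : ℝ} (P : Ici η → Ω → ℕ) (n : ℕ) (ω : Ω) :
    BddBelow {t : ℝ | ∃ h : η ≤ t, n + 1 ≤ P ⟨t, h⟩ ω} :=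
  ⟨η, fun _ ht => ht.1⟩

omit [MeasurableSpace Ω] in
lemma jumpTime_mem_Icc {η : ℝ} {P : Ici η → Ω → ℕ} {ω : Ω} (hmono : Monotone fun t => P t ω)
    {a b : Ici η} {n : ℕ} (hn : n ∈ Finset.Ioc (P a ω) (P b ω)) :
    jumpTime P n ω ∈ Icc (a : ℝ) b := by
  obtain ⟨h1, h2⟩ := Finset.mem_Ioc.1 hn
  obtain ⟨n, rfl⟩ : ∃ m, n = m + 1 := ⟨n - 1, by omega⟩
  have hb : (b : ℝ) ∈ {t : ℝ | ∃ h : η ≤ t, n + 1 ≤ P ⟨t, h⟩ ω} := ⟨b.2, h2⟩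
  refine ⟨le_csInf ⟨_, hb⟩ ?_, csInf_le (bddBelow_jumpSet P n ω) hb⟩
  rintro t ⟨ht, hPt⟩
  by_contra hlt
  have : P ⟨t, ht⟩ ω ≤ P a ω := hmono (Subtype.mk_le_mk.2 (not_le.1 hlt).le)
  omega

omit [MeasurableSpace Ω] in
lemma jumpTime_succ_lt_iff {η : ℝ} {P : Ici η → Ω → ℕ} {ω : Ω}
    (hmono : Monotone fun t => P t ω) (n : ℕ) (t : ℝ) :
    jumpTime P (n + 1) ω < t ↔
      (∃ q : ℚ, ∃ h : η ≤ q, (q : ℝ) < t ∧ n + 1 ≤ P ⟨q, h⟩ ω) ∨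
      (0 < t ∧ ∀ q : ℚ, ∀ h : η ≤ q, P ⟨q, h⟩ ω < n + 1) := by
  have key : ∀ s : ℝ, ∀ hs : η ≤ s, n + 1 ≤ P ⟨s, hs⟩ ω → ∀ t, s < t →
      ∃ q : ℚ, ∃ h : η ≤ q, (q : ℝ) < t ∧ n + 1 ≤ P ⟨q, h⟩ ω := by
    intro s hs hP t hst
    obtain ⟨q, hq1, hq2⟩ := exists_rat_btwn hst
    exact ⟨q, hs.trans hq1.le, hq2, hP.trans (hmono (Subtype.mk_le_mk.2 hq1.le))⟩
  simp only [jumpTime]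
  rcases Set.eq_empty_or_nonempty {t : ℝ | ∃ h : η ≤ t, n + 1 ≤ P ⟨t, h⟩ ω} with he | hne
  · rw [he, Real.sInf_empty]
    have he' : ∀ s : ℝ, ∀ hs : η ≤ s, P ⟨s, hs⟩ ω < n + 1 := fun s hs => by
      by_contra hlt
      exact (Set.eq_empty_iff_forall_notMem.1 he s) ⟨hs, not_lt.1 hlt⟩
    constructor
    · exact fun h => .inr ⟨h, fun q h => he' q h⟩
    · rintro (⟨q, h, -, h2⟩ | h)
      · exact absurd (he' q h) (not_lt.2 h2)
      · exact h.1
  · constructor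
    · intro h
      obtain ⟨s, ⟨hs, hP⟩, hst⟩ := exists_lt_of_csInf_lt hne h
      exact .inl (key s hs hP t hst)
    · rintro (⟨q, h, hqt, h2⟩ | ⟨-, h⟩)
      · exact (csInf_le (bddBelow_jumpSet P n ω) ⟨h, h2⟩).trans_lt hqt
      · obtain ⟨s, hs, hP⟩ := hne
        obtain ⟨q, hq, -, hq2⟩ := key s hs hP (s + 1) (by linarith)
        exact absurd (h q hq) (not_lt.2 hq2)

lemma aemeasurable_jumpTime {μ : Measure Ω} {η : ℝ} {P : Ici η → Ω → ℕ}
    (hP : ∀ t, Measurable (P t)) (hmono : ∀ᵐ ω ∂μ, Monotone fun t => P t ω) (n : ℕ) :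
    AEMeasurable (jumpTime P n) μ := by
  cases n with
  | zero => exact aemeasurable_const (b := η)
  | succ n =>
    have h : NullMeasurable (jumpTime P (n + 1)) μ := by
      refine @measurable_of_Iio ℝ (NullMeasurableSpace Ω μ) _ _ _ _ _ _ _ _ fun t => ?_
      have hm : MeasurableSet {ω | (∃ q : ℚ, ∃ h : η ≤ q, (q : ℝ) < t ∧ n + 1 ≤ P ⟨q, h⟩ ω) ∨
          (0 < t ∧ ∀ q : ℚ, ∀ h : η ≤ q, P ⟨q, h⟩ ω < n + 1)} := by
        have h1 : ∀ s : Ici η, MeasurableSet {ω | n + 1 ≤ P s ω} := fun s =>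
          measurableSet_le measurable_const (hP s)
        have h2 : ∀ s : Ici η, MeasurableSet {ω | P s ω < n + 1} := fun s =>
          measurableSet_lt (hP s) measurable_const
        refine (Measurable.or ?_ (.and measurable_const ?_)).setOf
        · exact .exists fun q => .exists fun h => .and measurable_const
            (measurableSet_setOfPred.1 (h1 _))
        · exact .forall fun q => .forall fun h => measurableSet_setOfPred.1 (h2 _)
      refine hm.nullMeasurableSet.congr ?_
      filter_upwards [hmono] with ω hω
      exact propext (jumpTime_succ_lt_iff hω n t).symm
    exact h.aemeasurable

/-! ### Expectations of powers of Poisson increments -/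

lemma integral_pow_poissonMeasure (r : ℝ≥0) (z : ℝ) :
    ∫ n : ℕ, z ^ n ∂(poissonMeasure r) = Real.exp (-((1 - z) * r)) := by
  rw [integral_poissonMeasure]
  have : ∀ n : ℕ, (Real.exp (-r) * r ^ n / n.factorial) • z ^ n =
      Real.exp (-r) * ((r * z) ^ n / n.factorial) := fun n => by
    rw [smul_eq_mul, mul_pow]; ring
  simp only [this]
  rw [tsum_mul_left, (NormedSpace.expSeries_div_hasSum_exp (r * z : ℝ)).tsum_eq,
    ← Real.exp_eq_exp_ℝ, ← Real.exp_add]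
  congr 1; ring

lemma integral_two_div {a b : ℝ} (ha : 0 < a) (hb : 0 < b) :
    ∫ u in a..b, 2 / u = 2 * Real.log (b / a) := by
  simp only [div_eq_mul_inv (2 : ℝ)]
  rw [intervalIntegral.integral_const_mul, integral_inv_of_pos ha hb]

lemma integral_prod_pow_increments {μ : Measure Ω} [IsProbabilityMeasure μ] {η : ℝ} (hη : 0 < η)
    {P : Ici η → Ω → ℕ} (hP : IsPoissonProcess μ η (fun t => 2 / t) P) {x : ℕ → Ici η}
    (hx : Monotone x) (c : ℕ → ℝ) (K : ℕ) :
    ∫ ω, ∏ i ∈ Finset.range K, c i ^ (P (x (i + 1)) ω - P (x i) ω) ∂μ =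
      ∏ i ∈ Finset.range K,
        Real.exp (-((1 - c i) * (2 * Real.log ((x (i + 1) : ℝ) / x i)))) := by
  simp only [Finset.prod_range]
  have hind : iIndepFun (fun (i : Fin K) ω => P (x (i + 1)) ω - P (x i) ω) μ :=
    (hP.indep.nat hx).precomp Fin.val_injective
  have hm : ∀ i, Measurable fun ω => P (x (i + 1)) ω - P (x i) ω := fun i =>
    (hP.measurable _).sub (hP.measurable _)
  rw [hind.integral_fun_prod_comp (f := fun (i : Fin K) n => c i ^ n)
    (fun i => (hm i).aemeasurable) (fun i => by fun_prop)]
  refine Finset.prod_congr rfl fun i _ => ?_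
  have hpos : ∀ j, 0 < (x j : ℝ) := fun j => hη.trans_le (x j).2
  have hle : (x i : ℝ) ≤ x (i + 1) := hx (Nat.le_succ _)
  have h := (hP.law (x i) (x (i + 1)) (hx (Nat.le_succ _))).integral_comp
    (f := fun n => c i ^ n) (by fun_prop)
  simp only [Function.comp_def] at h
  rw [h, integral_pow_poissonMeasure, integral_two_div (hpos _) (hpos _), Real.coe_toNNReal]
  have := Real.log_nonneg ((one_le_div (hpos i)).2 hle)
  positivity

/-! ### Products over the jump times -/

lemma measurable_comp_of_countable {ι β : Type*} [Countable ι] [MeasurableSpace ι]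
    [MeasurableSingletonClass ι] [MeasurableSpace β] {Y : Ω → ι} (hY : Measurable Y)
    {F : ι → Ω → β} (hF : ∀ i, Measurable (F i)) : Measurable fun ω => F (Y ω) ω := by
  have : Measurable fun p : ι × Ω => F p.1 p.2 := measurable_from_prod_countable_right hF
  exact this.comp (hY.prodMk measurable_id)

/-- The product of `1 / (1 + 𝒯ₙ² v²)` over the jumps in `(a, b]`. -/
noncomputable def jumpProd {η : ℝ} (P : Ici η → Ω → ℕ) (v : ℝ) (a b : Ici η) (ω : Ω) : ℝ :=
  ∏ n ∈ Finset.Ioc (P a ω) (P b ω), lapFactor v (jumpTime P n ω)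

omit [MeasurableSpace Ω] in
lemma jumpProd_nonneg {η : ℝ} (P : Ici η → Ω → ℕ) (v : ℝ) (a b : Ici η) (ω : Ω) :
    0 ≤ jumpProd P v a b ω := Finset.prod_nonneg fun _ _ => (lapFactor_pos _ _).le

omit [MeasurableSpace Ω] in
lemma jumpProd_le_one {η : ℝ} (P : Ici η → Ω → ℕ) (v : ℝ) (a b : Ici η) (ω : Ω) :
    jumpProd P v a b ω ≤ 1 :=
  Finset.prod_le_one (fun _ _ => (lapFactor_pos _ _).le) fun _ _ => lapFactor_le_one _ _

lemma aemeasurable_jumpProd {μ : Measure Ω} {η : ℝ} {P : Ici η → Ω → ℕ}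
    (hP : ∀ t, Measurable (P t)) (hmono : ∀ᵐ ω ∂μ, Monotone fun t => P t ω) (v : ℝ)
    (a b : Ici η) : AEMeasurable (jumpProd P v a b) μ := by
  have hT := aemeasurable_jumpTime hP hmono
  refine ⟨fun ω => ∏ n ∈ Finset.Ioc (P a ω) (P b ω), lapFactor v ((hT n).mk _ ω), ?_, ?_⟩
  · refine measurable_comp_of_countable ((hP a).prodMk (hP b))
      (F := fun p ω => ∏ n ∈ Finset.Ioc p.1 p.2, lapFactor v ((hT n).mk _ ω)) fun p => ?_
    exact Finset.measurable_fun_prod _ fun n _ => (measurable_lapFactor v).comp (hT n).measurable_mk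
  · filter_upwards [ae_all_iff.2 fun n => (hT n).ae_eq_mk] with ω hω
    exact Finset.prod_congr rfl fun n _ => by rw [hω n]

omit [MeasurableSpace Ω] in
lemma le_jumpProd {η : ℝ} (hη : 0 < η) {P : Ici η → Ω → ℕ} {ω : Ω}
    (hmono : Monotone fun t => P t ω) (v : ℝ) (a b : Ici η) :
    lapFactor v b ^ (P b ω - P a ω) ≤ jumpProd P v a b ω := by
  rw [← Nat.card_Ioc, ← Finset.prod_const]
  refine Finset.prod_le_prod (fun _ _ => (lapFactor_pos _ _).le) fun n hn => ?_
  have h := jumpTime_mem_Icc hmono hn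
  exact lapFactor_anti v ((hη.trans_le a.2).le.trans h.1) h.2

omit [MeasurableSpace Ω] in
lemma jumpProd_le {η : ℝ} (hη : 0 < η) {P : Ici η → Ω → ℕ} {ω : Ω}
    (hmono : Monotone fun t => P t ω) (v : ℝ) (a b : Ici η) :
    jumpProd P v a b ω ≤ lapFactor v a ^ (P b ω - P a ω) := by
  rw [← Nat.card_Ioc, ← Finset.prod_const]
  refine Finset.prod_le_prod (fun _ _ => (lapFactor_pos _ _).le) fun n hn => ?_
  exact lapFactor_anti v (hη.trans_le a.2).le (jumpTime_mem_Icc hmono hn).1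

lemma integrable_prod_of_mem_Icc {μ : Measure Ω} [IsFiniteMeasure μ] {F : ℕ → Ω → ℝ}
    (hF : ∀ i, AEMeasurable (F i) μ) (h0 : ∀ i ω, 0 ≤ F i ω) (h1 : ∀ i ω, F i ω ≤ 1) (K : ℕ) :
    Integrable (fun ω => ∏ i ∈ Finset.range K, F i ω) μ := by
  refine Integrable.of_bound (Finset.aemeasurable_fun_prod _ fun i _ => hF i).aestronglyMeasurable
    1 (.of_forall fun ω => ?_)
  rw [Real.norm_eq_abs, abs_of_nonneg (Finset.prod_nonneg fun i _ => h0 i ω)]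
  exact Finset.prod_le_one (fun i _ => h0 i ω) fun i _ => h1 i ω

lemma abs_integral_jumpProd_sub_le {μ : Measure Ω} [IsProbabilityMeasure μ] {η : ℝ} (hη : 0 < η)
    {P : Ici η → Ω → ℕ} (hP : IsPoissonProcess μ η (fun t => 2 / t) P) {x : ℕ → Ici η}
    (hx : Monotone x) (v : ℕ → ℝ) (K : ℕ) :
    |∫ ω, ∏ i ∈ Finset.range K, jumpProd P (v i) (x i) (x (i + 1)) ω ∂μ -
      ∏ i ∈ Finset.range K, lapFactor (v i) (x (i + 1)) / lapFactor (v i) (x i)| ≤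
      ∑ i ∈ Finset.range K, (2 * Real.log ((x (i + 1) : ℝ) / x i)) ^ 2 := by
  have hpos : ∀ j, 0 < (x j : ℝ) := fun j => hη.trans_le (x j).2
  have hle : ∀ i, (x i : ℝ) ≤ x (i + 1) := fun i => hx (Nat.le_succ i)
  have hlog : ∀ i, 0 ≤ 2 * Real.log ((x (i + 1) : ℝ) / x i) := fun i => by
    have := Real.log_nonneg ((one_le_div (hpos i)).2 (hle i))
    positivity
  have hmeas : ∀ (c : ℕ → ℝ) i, Measurable fun ω => c i ^ (P (x (i + 1)) ω - P (x i) ω) :=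
    fun c i => (measurable_of_countable fun n : ℕ => c i ^ n).comp
      ((hP.measurable _).sub (hP.measurable _))
  have hpow : ∀ (c : ℕ → ℝ), (∀ i, 0 ≤ c i) → (∀ i, c i ≤ 1) →
      Integrable (fun ω => ∏ i ∈ Finset.range K, c i ^ (P (x (i + 1)) ω - P (x i) ω)) μ :=
    fun c h0 h1 => integrable_prod_of_mem_Icc (fun i => (hmeas c i).aemeasurable)
      (fun i ω => pow_nonneg (h0 i) _) (fun i ω => pow_le_one₀ (h0 i) (h1 i)) K
  have hmid : Integrable (fun ω => ∏ i ∈ Finset.range K,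
      jumpProd P (v i) (x i) (x (i + 1)) ω) μ :=
    integrable_prod_of_mem_Icc (fun i => aemeasurable_jumpProd hP.measurable hP.mono _ _ _)
      (fun i ω => jumpProd_nonneg _ _ _ _ _) (fun i ω => jumpProd_le_one _ _ _ _ _) K
  have hlow := integral_mono_ae (hpow (fun i => lapFactor (v i) (x (i + 1)))
    (fun i => (lapFactor_pos _ _).le) fun i => lapFactor_le_one _ _) hmid (by
      filter_upwards [hP.mono] with ω hω
      exact Finset.prod_le_prod (fun i _ => pow_nonneg (lapFactor_pos _ _).le _)
        fun i _ => le_jumpProd hη hω _ _ _)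
  have hup := integral_mono_ae hmid (hpow (fun i => lapFactor (v i) (x i))
    (fun i => (lapFactor_pos _ _).le) fun i => lapFactor_le_one _ _) (by
      filter_upwards [hP.mono] with ω hω
      exact Finset.prod_le_prod (fun i _ => jumpProd_nonneg _ _ _ _ _)
        fun i _ => jumpProd_le hη hω _ _ _)
  rw [integral_prod_pow_increments hη hP hx] at hlow hup
  have hlow' : ∏ i ∈ Finset.range K, Real.exp (-((1 - lapFactor (v i) (x (i + 1))) *
      (2 * Real.log ((x (i + 1) : ℝ) / x i)))) ≤
      ∏ i ∈ Finset.range K, lapFactor (v i) (x (i + 1)) / lapFactor (v i) (x i) :=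
    Finset.prod_le_prod (fun i _ => (Real.exp_pos _).le)
      fun i _ => exp_le_lapFactor_div _ (hpos _) (hpos _)
  have hup' : ∏ i ∈ Finset.range K, lapFactor (v i) (x (i + 1)) / lapFactor (v i) (x i) ≤
      ∏ i ∈ Finset.range K, Real.exp (-((1 - lapFactor (v i) (x i)) *
        (2 * Real.log ((x (i + 1) : ℝ) / x i)))) :=
    Finset.prod_le_prod (fun i _ => (div_pos (lapFactor_pos _ _) (lapFactor_pos _ _)).le)
      fun i _ => lapFactor_div_le_exp _ (hpos _) (hpos _)
  have hgap := exp_sum_sub_exp_sum_le (K := K)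
    (u := fun i => (1 - lapFactor (v i) (x i)) * (2 * Real.log ((x (i + 1) : ℝ) / x i)))
    (l := fun i => (1 - lapFactor (v i) (x (i + 1))) * (2 * Real.log ((x (i + 1) : ℝ) / x i)))
    (c := fun i => (2 * Real.log ((x (i + 1) : ℝ) / x i)) ^ 2)
    (fun i => mul_nonneg (sub_nonneg.2 (lapFactor_le_one _ _)) (hlog i)) (fun i => sq_nonneg _)
    (fun i => by
      rw [← sub_mul, sq]
      exact mul_le_mul_of_nonneg_right
        (by linarith [lapFactor_sub_le (v i) (hpos i) (hle i)]) (hlog i))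
  rw [abs_le]
  constructor <;> linarith

/-! ### Refinement of a partition -/

lemma exists_refinement {η : ℝ} (hη : 0 < η) {x : ℕ → Ici η} (hx : Monotone x) {m : ℕ}
    (hm : 0 < m) :
    ∃ y : ℕ → Ici η, Monotone y ∧ (∀ k, y (k * m) = x k) ∧
      ∀ k r, r < m → Real.log ((y (k * m + r + 1) : ℝ) / y (k * m + r)) =
        Real.log ((x (k + 1) : ℝ) / x k) / m := by
  have hpos : ∀ j, 0 < (x j : ℝ) := fun j => hη.trans_le (x j).2
  have hm' : (0 : ℝ) < m := by exact_mod_cast hm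
  set D : ℕ → ℝ := fun k => Real.log (x (k + 1)) - Real.log (x k) with hD
  have hD0 : ∀ k, 0 ≤ D k := fun k =>
    sub_nonneg.2 (Real.log_le_log (hpos k) (hx (Nat.le_succ k)))
  have hDlog : ∀ k, Real.log ((x (k + 1) : ℝ) / x k) = D k := fun k =>
    Real.log_div (hpos _).ne' (hpos _).ne'
  set g : ℕ → ℝ := fun j => Real.log (x (j / m)) + ((j % m : ℕ) : ℝ) / m * D (j / m) with hg
  have hgr : ∀ k r, r ≤ m → g (k * m + r) = Real.log (x k) + (r : ℝ) / m * D k := by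
    intro k r hr
    rcases hr.lt_or_eq with hr | rfl
    · simp only [hg]
      rw [mul_comm k m, Nat.mul_add_div hm, Nat.div_eq_of_lt hr, Nat.mul_add_mod,
        Nat.mod_eq_of_lt hr, add_zero]
    · simp only [hg]
      rw [← Nat.succ_mul, Nat.mul_mod_left, Nat.mul_div_cancel _ hm, div_self hm'.ne', hD]
      simp
  have hstep : ∀ k r, r < m → g (k * m + r + 1) = g (k * m + r) + D k / m := by
    intro k r hr
    rw [add_assoc, hgr k (r + 1) hr, hgr k r hr.le]
    push_cast
    ring
  have hgmono : Monotone g := by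
    refine monotone_nat_of_le_succ fun j => ?_
    have h := hstep (j / m) (j % m) (Nat.mod_lt _ hm)
    rw [Nat.div_add_mod'] at h
    rw [h]
    have := hD0 (j / m)
    have : 0 ≤ D (j / m) / m := by positivity
    linarith
  have hη' : ∀ j, η ≤ Real.exp (g j) := by
    intro j
    rw [← Real.log_le_iff_le_exp hη]
    refine (Real.log_le_log hη (x (j / m)).2).trans ?_
    have := hD0 (j / m)
    simp only [hg]
    have : 0 ≤ ((j % m : ℕ) : ℝ) / m * D (j / m) := by positivity
    linarith
  refine ⟨fun j => ⟨Real.exp (g j), hη' j⟩, fun i j hij => ?_, fun k => ?_, fun k r hr => ?_⟩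
  · exact Subtype.mk_le_mk.2 (Real.exp_le_exp.2 (hgmono hij))
  · ext
    have := hgr k 0 hm.le
    simp only [add_zero, Nat.cast_zero, zero_div, zero_mul] at this
    simp only [this, Real.exp_log (hpos k)]
  · rw [hDlog, Real.log_div (Real.exp_pos _).ne' (Real.exp_pos _).ne', Real.log_exp, Real.log_exp,
      hstep k r hr]
    ring

/-! ### The expectation of products over the jump times -/

omit [MeasurableSpace Ω] in
lemma prod_jumpProd {η : ℝ} {P : Ici η → Ω → ℕ} {ω : Ω} (hmono : Monotone fun t => P t ω)
    {y : ℕ → Ici η} (hy : Monotone y) (v : ℝ) (j m : ℕ) :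
    ∏ r ∈ Finset.range m, jumpProd P v (y (j + r)) (y (j + r + 1)) ω =
      jumpProd P v (y j) (y (j + m)) ω := by
  have := prod_range_prod_Ioc (p := fun r => P (y (j + r)) ω)
    (fun a b hab => hmono (hy (by omega))) (fun n => lapFactor v (jumpTime P n ω)) m
  simpa [jumpProd, ← add_assoc] using this

/-- The Laplace functional of the Poisson process with intensity `2 / t`, for the functions
`1 / (1 + t² v²)` with `v` piecewise constant. -/
lemma integral_prod_jumpProd {μ : Measure Ω} [IsProbabilityMeasure μ] {η : ℝ} (hη : 0 < η)
    {P : Ici η → Ω → ℕ} (hP : IsPoissonProcess μ η (fun t => 2 / t) P) {x : ℕ → Ici η}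
    (hx : Monotone x) (v : ℕ → ℝ) (K : ℕ) :
    ∫ ω, ∏ k ∈ Finset.range K, jumpProd P (v k) (x k) (x (k + 1)) ω ∂μ =
      ∏ k ∈ Finset.range K, lapFactor (v k) (x (k + 1)) / lapFactor (v k) (x k) := by
  set S := ∑ k ∈ Finset.range K, (2 * Real.log ((x (k + 1) : ℝ) / x k)) ^ 2 with hS
  have hbound : ∀ m : ℕ, 0 < m →
      |∫ ω, ∏ k ∈ Finset.range K, jumpProd P (v k) (x k) (x (k + 1)) ω ∂μ -
        ∏ k ∈ Finset.range K, lapFactor (v k) (x (k + 1)) / lapFactor (v k) (x k)| ≤ S / m := by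
    intro m hm
    have hm' : (m : ℝ) ≠ 0 := by exact_mod_cast hm.ne'
    obtain ⟨y, hy, hyx, hlog⟩ := exists_refinement hη hx hm
    have hdiv : ∀ k r, r < m → (k * m + r) / m = k := fun k r hr => by
      rw [mul_comm k m, Nat.mul_add_div hm, Nat.div_eq_of_lt hr, add_zero]
    have hyx' : ∀ k, y (k * m + m) = x (k + 1) := fun k => by rw [← Nat.succ_mul, hyx]
    have h := abs_integral_jumpProd_sub_le hη hP hy (fun j => v (j / m)) (K * m)
    simp only [prod_range_blocks, sum_range_blocks] at h
    have e1 : ∫ ω, ∏ k ∈ Finset.range K, ∏ r ∈ Finset.range m,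
        jumpProd P (v ((k * m + r) / m)) (y (k * m + r)) (y (k * m + r + 1)) ω ∂μ =
        ∫ ω, ∏ k ∈ Finset.range K, jumpProd P (v k) (x k) (x (k + 1)) ω ∂μ := by
      refine integral_congr_ae ?_
      filter_upwards [hP.mono] with ω hω
      refine Finset.prod_congr rfl fun k _ => ?_
      rw [← hyx k, ← hyx' k, ← prod_jumpProd hω hy]
      refine Finset.prod_congr rfl fun r hr => ?_
      rw [hdiv k r (Finset.mem_range.1 hr)]
    have e2 : ∏ k ∈ Finset.range K, ∏ r ∈ Finset.range m,
        lapFactor (v ((k * m + r) / m)) (y (k * m + r + 1)) /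
          lapFactor (v ((k * m + r) / m)) (y (k * m + r)) =
        ∏ k ∈ Finset.range K, lapFactor (v k) (x (k + 1)) / lapFactor (v k) (x k) := by
      refine Finset.prod_congr rfl fun k _ => ?_
      have := prod_range_div_of_ne_zero (g := fun r => lapFactor (v k) (y (k * m + r)))
        (fun r => (lapFactor_pos _ _).ne') m
      simp only [add_zero, hyx, hyx'] at this
      rw [← this]
      refine Finset.prod_congr rfl fun r hr => ?_
      rw [hdiv k r (Finset.mem_range.1 hr), add_assoc]
    have e3 : ∑ k ∈ Finset.range K, ∑ r ∈ Finset.range m,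
        (2 * Real.log ((y (k * m + r + 1) : ℝ) / y (k * m + r))) ^ 2 = S / m := by
      rw [hS, Finset.sum_div]
      refine Finset.sum_congr rfl fun k _ => ?_
      rw [Finset.sum_congr rfl fun r hr => by rw [hlog k r (Finset.mem_range.1 hr)],
        Finset.sum_const, Finset.card_range, nsmul_eq_mul]
      field_simp
    rwa [e1, e2, e3] at h
  have h0 := ge_of_tendsto (tendsto_const_div_atTop_nhds_zero_nat S)
    (Filter.eventually_atTop.2 ⟨1, fun m hm => hbound m hm⟩)
  exact sub_eq_zero.1 (abs_eq_zero.1 (le_antisymm h0 (abs_nonneg _)))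

/-! ### Conditioning on the Poisson process -/

lemma setIntegral_cexp_eq {μ : Measure Ω} [IsProbabilityMeasure μ] {η : ℝ}
    {P : Ici η → Ω → ℕ} (hP : ∀ t, Measurable (P t))
    (hmono : ∀ᵐ ω ∂μ, Monotone fun t => P t ω)
    {X : ℕ → Ω → ℝ} (hX : IsLaplaceJumps μ P X) {A : Set Ω} (hA : MeasurableSet[processSigma P] A)
    (N : ℕ) (hpos : ∀ᵐ ω ∂μ, ω ∈ A → ∀ n < N, 0 < jumpTime P n ω) (w : ℕ → ℝ) :
    ∫ ω in A, Complex.exp ((∑ n ∈ Finset.range N, w n * X n ω : ℝ) * Complex.I) ∂μ =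
      ∫ ω in A, ((∏ n ∈ Finset.range N, lapFactor (w n) (jumpTime P n ω) : ℝ) : ℂ) ∂μ := by
  have hle : processSigma P ≤ ‹MeasurableSpace Ω› := iSup_le fun t => (hP t).comap_le
  have hA' : MeasurableSet A := hle A hA
  have := isProbabilityMeasure_laplaceMeasure one_pos
  have hT := aemeasurable_jumpTime hP hmono
  set T : ℕ → Ω → ℝ := fun n => (hT n).mk _ with hTdef
  have hTm : ∀ n, Measurable (T n) := fun n => (hT n).measurable_mk
  have hTe : ∀ᵐ ω ∂μ, ∀ n, jumpTime P n ω = T n ω := ae_all_iff.2 fun n => (hT n).ae_eq_mk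
  have hTA : ∀ᵐ ω ∂(μ.restrict A), ∀ n, jumpTime P n ω = T n ω := ae_restrict_of_ae hTe
  have hposA : ∀ᵐ ω ∂(μ.restrict A), ∀ n < N, 0 < jumpTime P n ω :=
    (ae_restrict_iff' hA').2 hpos
  set ν : Measure (Fin N → ℝ) := Measure.pi fun _ => laplaceMeasure 1 with hν
  have hΦ : Measurable fun (p : Ω × (Fin N → ℝ)) (n : Fin N) => T n p.1 * p.2 n :=
    measurable_pi_lambda _ fun n => ((hTm _).comp measurable_fst).mul
      ((measurable_pi_apply n).comp measurable_snd)
  have hXm : Measurable fun ω (n : Fin N) => X n ω :=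
    measurable_pi_lambda _ fun n => hX.measurable n
  have hlaw : (μ.restrict A).map (fun ω (n : Fin N) => X n ω) =
      ((μ.restrict A).prod ν).map
        fun (p : Ω × (Fin N → ℝ)) (n : Fin N) => T n p.1 * p.2 n := by
    refine ext_of_generate_finite _ generateFrom_pi.symm isPiSystem_pi ?_ ?_
    · rintro _ ⟨B, hB, rfl⟩
      have hB' : ∀ n, MeasurableSet (B n) := fun n => hB n (mem_univ n)
      set B' : ℕ → Set ℝ := fun n => if h : n < N then B ⟨n, h⟩ else univ with hB'def
      have hBB : ∀ n : Fin N, B' n = B n := fun n => dif_pos n.2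
      have hB'm : ∀ n, MeasurableSet (B' n) := fun n => by
        by_cases h : n < N
        · simpa [hB'def, h] using hB' ⟨n, h⟩
        · simp [hB'def, h]
      have hpre : (fun ω (n : Fin N) => X n ω) ⁻¹' (univ.pi B) ∩ A =
          A ∩ ⋂ n ∈ Finset.range N, X n ⁻¹' B' n := by
        ext ω
        simp only [mem_inter_iff, mem_preimage, mem_univ_pi, mem_iInter, Finset.mem_range,
          and_comm (a := ω ∈ A), ← hBB]
        exact and_congr_left fun _ => ⟨fun h n hn => h ⟨n, hn⟩, fun h n => h n n.2⟩
      have hBpi : MeasurableSet (univ.pi B) := .univ_pi hB'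
      rw [Measure.map_apply hXm hBpi, Measure.restrict_apply (hXm hBpi), hpre,
        hX.condLaw A hA N B' hB'm, Measure.map_apply hΦ hBpi, Measure.prod_apply (hΦ hBpi)]
      refine lintegral_congr_ae ?_
      filter_upwards [hTA, hposA] with ω hω hω'
      have hpre2 : Prod.mk ω ⁻¹' ((fun (p : Ω × (Fin N → ℝ)) (n : Fin N) => T n p.1 * p.2 n) ⁻¹'
          univ.pi B) = univ.pi fun n : Fin N => (fun y => T n ω * y) ⁻¹' B n := by
        ext y
        simp
      rw [hpre2, hν, Measure.pi_pi, Finset.prod_range]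
      refine Finset.prod_congr rfl fun n _ => ?_
      rw [← map_mul_laplaceMeasure_one (hω' n n.2), Measure.map_apply (by fun_prop) (hB'm n),
        hω n, hBB n]
    · rw [Measure.map_apply hXm .univ, Measure.map_apply hΦ .univ, preimage_univ, preimage_univ,
        ← univ_prod_univ, Measure.prod_prod]
      simp
  set F : (Fin N → ℝ) → ℂ := fun x => Complex.exp ((∑ n : Fin N, w n * x n : ℝ) * Complex.I)
    with hF
  have hFm : Measurable F := by fun_prop
  have hFn : ∀ x, ‖F x‖ = 1 := fun x => Complex.norm_exp_ofReal_mul_I _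
  have h1 : ∫ ω in A, Complex.exp ((∑ n ∈ Finset.range N, w n * X n ω : ℝ) * Complex.I) ∂μ =
      ∫ x, F x ∂((μ.restrict A).map (fun ω (n : Fin N) => X n ω)) := by
    rw [integral_map hXm.aemeasurable hFm.aestronglyMeasurable]
    simp only [hF, Finset.sum_range]
  rw [h1, hlaw, integral_map hΦ.aemeasurable hFm.aestronglyMeasurable, integral_prod]
  · refine integral_congr_ae ?_
    filter_upwards [hTA] with ω hω
    have h2 : ∀ y : Fin N → ℝ, F (fun n => T n ω * y n) =
        ∏ n : Fin N, Complex.exp ((w n * T n ω : ℝ) * (y n : ℝ) * Complex.I) := fun y => by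
      rw [hF, ← Complex.exp_sum, ← Finset.sum_mul]
      push_cast
      simp only [mul_assoc]
    simp only [h2]
    rw [hν, integral_fintype_prod_eq_prod
      (f := fun (n : Fin N) (y : ℝ) => Complex.exp ((w n * T n ω : ℝ) * (y : ℝ) * Complex.I)),
      Finset.prod_range]
    push_cast
    refine Finset.prod_congr rfl fun n _ => ?_
    have := charFun_laplaceMeasure one_pos (w n * T n ω)
    rw [charFun_apply_real] at this
    push_cast at this
    rw [this, hω n, lapFactor, lapFactor]
    congr 2; ring
  · exact Integrable.of_bound (hFm.comp hΦ).aestronglyMeasurable 1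
      (.of_forall fun p => (hFn _).le)

/-- Integration of a function of countably many values of the process and of the jumps, given the
process. -/
lemma integral_cexp_eq_of_countable {μ : Measure Ω} [IsProbabilityMeasure μ] {η : ℝ}
    {P : Ici η → Ω → ℕ} (hP : ∀ t, Measurable (P t))
    (hmono : ∀ᵐ ω ∂μ, Monotone fun t => P t ω)
    {X : ℕ → Ω → ℝ} (hX : IsLaplaceJumps μ P X) {ι : Type*} [Countable ι] [MeasurableSpace ι]
    [MeasurableSingletonClass ι] {Y : Ω → ι} (hY : Measurable[processSigma P] Y) (N : ι → ℕ)
    (W : ι → ℕ → ℝ) (hpos : ∀ᵐ ω ∂μ, ∀ n < N (Y ω), 0 < jumpTime P n ω) :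
    ∫ ω, Complex.exp ((∑ n ∈ Finset.range (N (Y ω)), W (Y ω) n * X n ω : ℝ) * Complex.I) ∂μ =
      ((∫ ω, ∏ n ∈ Finset.range (N (Y ω)), lapFactor (W (Y ω) n) (jumpTime P n ω) ∂μ : ℝ) : ℂ) := by
  have hle : processSigma P ≤ ‹MeasurableSpace Ω› := iSup_le fun t => (hP t).comap_le
  have hY' : Measurable Y := hY.mono hle le_rfl
  have hT := aemeasurable_jumpTime hP hmono
  have hA : ∀ i, MeasurableSet[processSigma P] (Y ⁻¹' {i}) := fun i => hY (measurableSet_singleton i)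
  have hU : ⋃ i, Y ⁻¹' {i} = univ := eq_univ_of_forall fun ω => mem_iUnion.2 ⟨Y ω, rfl⟩
  have hdisj : Pairwise (Function.onFun Disjoint fun i => Y ⁻¹' {i}) := fun i j hij =>
    Disjoint.preimage _ (by simpa using hij)
  have hF : Integrable (fun ω => Complex.exp
      ((∑ n ∈ Finset.range (N (Y ω)), W (Y ω) n * X n ω : ℝ) * Complex.I)) μ := by
    refine Integrable.of_bound (C := 1) ?_ (.of_forall fun ω => ?_)
    · refine (measurable_comp_of_countable hY' (F := fun i ω => Complex.exp
        ((∑ n ∈ Finset.range (N i), W i n * X n ω : ℝ) * Complex.I)) fun i => ?_).aestronglyMeasurable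
      have := hX.measurable
      fun_prop
    · rw [Complex.norm_exp_ofReal_mul_I]
  have hG' : Integrable (fun ω => ∏ n ∈ Finset.range (N (Y ω)),
      lapFactor (W (Y ω) n) (jumpTime P n ω)) μ := by
    refine Integrable.of_bound (C := 1) ?_ (.of_forall fun ω => ?_)
    · refine AEMeasurable.aestronglyMeasurable
        ⟨fun ω => ∏ n ∈ Finset.range (N (Y ω)), lapFactor (W (Y ω) n) ((hT n).mk _ ω), ?_, ?_⟩
      · refine measurable_comp_of_countable hY'
          (F := fun i ω => ∏ n ∈ Finset.range (N i), lapFactor (W i n) ((hT n).mk _ ω)) fun i => ?_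
        exact Finset.measurable_fun_prod _ fun n _ =>
          (measurable_lapFactor _).comp (hT n).measurable_mk
      · filter_upwards [ae_all_iff.2 fun n => (hT n).ae_eq_mk] with ω hω
        exact Finset.prod_congr rfl fun n _ => by rw [hω n]
    · rw [Real.norm_eq_abs, abs_of_nonneg (Finset.prod_nonneg fun _ _ => (lapFactor_pos _ _).le)]
      exact Finset.prod_le_one (fun _ _ => (lapFactor_pos _ _).le) fun _ _ => lapFactor_le_one _ _
  have hG : Integrable (fun ω => ((∏ n ∈ Finset.range (N (Y ω)),
      lapFactor (W (Y ω) n) (jumpTime P n ω) : ℝ) : ℂ)) μ := hG'.ofReal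
  rw [← integral_complex_ofReal, ← setIntegral_univ, ← setIntegral_univ (μ := μ)
    (f := fun ω => ((∏ n ∈ Finset.range (N (Y ω)),
      lapFactor (W (Y ω) n) (jumpTime P n ω) : ℝ) : ℂ)), ← hU,
    integral_iUnion (fun i => hle _ (hA i)) hdisj hF.integrableOn,
    integral_iUnion (fun i => hle _ (hA i)) hdisj hG.integrableOn]
  refine tsum_congr fun i => ?_
  have h1 := setIntegral_cexp_eq hP hmono hX (hA i) (N i) (by
    filter_upwards [hpos] with ω hω hωi
    rw [mem_preimage, mem_singleton_iff] at hωi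
    rwa [hωi] at hω) (W i)
  rw [setIntegral_congr_fun (hle _ (hA i)) fun ω hω => ?_, h1,
    setIntegral_congr_fun (hle _ (hA i)) fun ω hω => ?_]
  · rw [mem_preimage, mem_singleton_iff] at hω
    simp only [hω]
  · rw [mem_preimage, mem_singleton_iff] at hω
    simp only [hω]

/-- The increment of the Laplace process over `(x k, x (k + 1)]`, the first one including the
initial value. -/
noncomputable def incr {η : ℝ} (P : Ici η → Ω → ℕ) (X : ℕ → Ω → ℝ) (x : ℕ → Ici η) (k : ℕ)
    (ω : Ω) : ℝ :=
  (if k = 0 then X 0 ω else 0) + ∑ n ∈ Finset.Ioc (P (x k) ω) (P (x (k + 1)) ω), X n ω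

lemma measurable_incr {η : ℝ} {P : Ici η → Ω → ℕ} {X : ℕ → Ω → ℝ} (hP : ∀ t, Measurable (P t))
    (hX : ∀ n, Measurable (X n)) (x : ℕ → Ici η) (k : ℕ) : Measurable (incr P X x k) := by
  refine Measurable.add ?_ ?_
  · split_ifs
    · exact hX 0
    · exact measurable_const
  · exact measurable_comp_of_countable ((hP (x k)).prodMk (hP (x (k + 1))))
      (F := fun p ω => ∑ n ∈ Finset.Ioc p.1 p.2, X n ω)
      fun p => Finset.measurable_fun_sum _ fun n _ => hX n

lemma integral_cexp_incr {μ : Measure Ω} [IsProbabilityMeasure μ] {η : ℝ} (hη : 0 < η)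
    {P : Ici η → Ω → ℕ} (hP : IsPoissonProcess μ η (fun t => 2 / t) P)
    {X : ℕ → Ω → ℝ} (hX : IsLaplaceJumps μ P X) {x : ℕ → Ici η} (hx : Monotone x)
    (hx0 : (x 0 : ℝ) = η) (v : ℕ → ℝ) (K : ℕ) (hv : K = 0 → v 0 = 0) :
    ∫ ω, Complex.exp ((∑ k ∈ Finset.range K, v k * incr P X x k ω : ℝ) * Complex.I) ∂μ =
      ((lapFactor (v 0) η * ∏ k ∈ Finset.range K,
        lapFactor (v k) (x (k + 1)) / lapFactor (v k) (x k) : ℝ) : ℂ) := by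
  classical
  have hx0' : x 0 = ⟨η, self_mem_Ici⟩ := Subtype.ext hx0
  let p : (Fin (K + 1) → ℕ) → ℕ → ℕ := fun q k => q ⟨min k K, by omega⟩
  let Y : Ω → Fin (K + 1) → ℕ := fun ω k => P (x k) ω
  have hY : Measurable[processSigma P] Y := by
    refine @measurable_pi_lambda _ _ _ (processSigma P) _ _ fun k => ?_
    exact (comap_measurable (P (x k))).mono (le_iSup (fun t => MeasurableSpace.comap (P t) ⊤) _)
      le_rfl
  have hidx : ∀ q, ∃ idx : ℕ → ℕ, Monotone (p q) →
      ∀ k n, n ∈ Finset.Ioc (p q k) (p q (k + 1)) → idx n = k := fun q => by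
    by_cases h : Monotone (p q)
    · obtain ⟨idx, hidx⟩ := exists_interval_index h
      exact ⟨idx, fun _ => hidx⟩
    · exact ⟨id, fun h' => absurd h' h⟩
  choose idx hidx using hidx
  have hpY : ∀ ω k, k ≤ K → p (Y ω) k = P (x k) ω := fun ω k hk => by
    simp only [p, Y, min_eq_left hk]
  have hpmono : ∀ ω, (Monotone fun t => P t ω) → Monotone (p (Y ω)) := fun ω hω i j hij =>
    hω (hx (by simp only []; omega))
  have hmain := integral_cexp_eq_of_countable hP.measurable hP.mono hX hY
    (fun q => p q K + 1) (fun q n => v (if n = 0 then 0 else idx q n)) (by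
      filter_upwards [hP.mono, hP.start] with ω hω h0 n hn
      rw [hpY ω K le_rfl] at hn
      rcases Nat.eq_zero_or_pos n with rfl | hn0
      · exact hη
      · have := jumpTime_mem_Icc hω (a := x 0) (b := x K) (n := n) (by
          rw [Finset.mem_Ioc, hx0', h0]; omega)
        exact (hη.trans_le (x 0).2).trans_le this.1)
  have hL : ∀ᵐ ω ∂μ, ∑ n ∈ Finset.range (p (Y ω) K + 1),
      v (if n = 0 then 0 else idx (Y ω) n) * X n ω =
      ∑ k ∈ Finset.range K, v k * incr P X x k ω := by
    filter_upwards [hP.mono, hP.start] with ω hω h0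
    have hp := hpmono ω hω
    have hp0 : p (Y ω) 0 = 0 := by rw [hpY ω 0 K.zero_le, hx0', h0]
    rw [sum_range_succ_eq_add_sum_Ioc hp hp0 (hidx _ hp) (fun k n => v k * X n ω)]
    simp only [incr, mul_add, Finset.sum_add_distrib]
    congr 1
    · rcases Nat.eq_zero_or_pos K with rfl | hK
      · simp [hv rfl]
      · rw [Finset.sum_eq_single 0 (fun k _ hk => by simp [hk])
          (fun h => absurd (Finset.mem_range.2 hK) h)]
        simp
    · refine Finset.sum_congr rfl fun k hk => ?_
      have := Finset.mem_range.1 hk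
      rw [Finset.mul_sum, hpY ω k (by omega), hpY ω (k + 1) (by omega)]
  have hR : ∀ᵐ ω ∂μ, ∏ n ∈ Finset.range (p (Y ω) K + 1),
      lapFactor (v (if n = 0 then 0 else idx (Y ω) n)) (jumpTime P n ω) =
      lapFactor (v 0) η * ∏ k ∈ Finset.range K, jumpProd P (v k) (x k) (x (k + 1)) ω := by
    filter_upwards [hP.mono, hP.start] with ω hω h0
    have hp := hpmono ω hω
    have hp0 : p (Y ω) 0 = 0 := by rw [hpY ω 0 K.zero_le, hx0', h0]
    rw [prod_range_succ_eq_mul_prod_Ioc hp hp0 (hidx _ hp)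
      (fun k n => lapFactor (v k) (jumpTime P n ω))]
    congr 1
    refine Finset.prod_congr rfl fun k hk => ?_
    have := Finset.mem_range.1 hk
    rw [hpY ω k (by omega), hpY ω (k + 1) (by omega)]
    rfl
  rw [← integral_prod_jumpProd hη hP hx, ← integral_const_mul, ← integral_congr_ae hR, ← hmain]
  refine integral_congr_ae ?_
  filter_upwards [hL] with ω hω
  rw [hω]

/-- The left end `t_{k-1}` of the `k`-th step, with `0` in place of the first one. -/
noncomputable def stepStart {η : ℝ} (x : ℕ → Ici η) (k : ℕ) : ℝ := if k = 0 then 0 else x k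

lemma hasLaw_incr {μ : Measure Ω} [IsProbabilityMeasure μ] {η : ℝ} (hη : 0 < η)
    {P : Ici η → Ω → ℕ} (hP : IsPoissonProcess μ η (fun t => 2 / t) P)
    {X : ℕ → Ω → ℝ} (hX : IsLaplaceJumps μ P X) {x : ℕ → Ici η} (hx : Monotone x)
    (hx0 : (x 0 : ℝ) = η) (K : ℕ) :
    HasLaw (fun ω (k : Fin K) => incr P X x k ω)
      (Measure.pi fun k : Fin K => incrLaw (stepStart x k) (x (k + 1))) μ := by
  have hpos : ∀ j, 0 < (x j : ℝ) := fun j => hη.trans_le (x j).2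
  have hs0 : ∀ k, 0 ≤ stepStart x k := fun k => by
    unfold stepStart; split_ifs; exacts [le_rfl, (hpos k).le]
  have hs1 : ∀ k, stepStart x k ≤ x (k + 1) := fun k => by
    unfold stepStart; split_ifs; exacts [(hpos _).le, hx (Nat.le_succ k)]
  have (k : Fin K) := isProbabilityMeasure_incrLaw (hs0 k) (hs1 k) (hpos (k + 1))
  have hm : Measurable fun ω (k : Fin K) => incr P X x k ω :=
    measurable_pi_lambda _ fun k => measurable_incr hP.measurable hX.measurable x k
  have := Measure.isProbabilityMeasure_map (μ := μ) hm.aemeasurable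
  refine ⟨hm.aemeasurable, charFun_eq_pi_iff.1 fun v => ?_⟩
  set v' : ℕ → ℝ := fun k => if h : k < K then v ⟨k, h⟩ else 0 with hv'
  have hvv : ∀ k : Fin K, v' k = v k := fun k => dif_pos k.2
  have h := integral_cexp_incr hη hP hX hx hx0 v' K (fun h => by simp [hv', h])
  rw [charFun_apply, integral_map (by fun_prop) (by fun_prop), integral_map hm.aemeasurable
    (by fun_prop)]
  have e1 : ∀ ω, ∑ k ∈ Finset.range K, v' k * incr P X x k ω =
      inner ℝ (WithLp.toLp 2 fun k : Fin K => incr P X x k ω) v := fun ω => by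
    rw [PiLp.inner_apply, Finset.sum_range]
    refine Finset.sum_congr rfl fun k _ => ?_
    rw [hvv]
    simp
  simp only [e1] at h
  rw [h]
  simp only [charFun_incrLaw (hs0 _) (hs1 _) (hpos _)]
  rw [← Complex.ofReal_prod]
  congr 1
  simp only [← hvv]
  rw [← Finset.prod_range (fun k => lapFactor (v' k) (x (k + 1)) / lapFactor (v' k) (stepStart x k))]
  rcases K with _ | K
  · simp [hv', lapFactor]
  · rw [Finset.prod_range_succ', Finset.prod_range_succ', mul_left_comm, mul_comm (lapFactor _ _),
      hx0]
    congr 1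
    rw [div_mul_cancel₀ _ (lapFactor_pos _ _).ne']
    simp [stepStart, lapFactor]

lemma exists_sequence_of_fin {η : ℝ} {K : ℕ} {t : Fin K → Ici η} (ht : Monotone t) :
    ∃ x : ℕ → Ici η, Monotone x ∧ (x 0 : ℝ) = η ∧ ∀ k : Fin K, x (k + 1) = t k := by
  rcases K with _ | K
  · exact ⟨fun _ => ⟨η, self_mem_Ici⟩, monotone_const, rfl, fun k => k.elim0⟩
  · refine ⟨fun n => n.casesOn ⟨η, self_mem_Ici⟩ fun k => t ⟨min k K, by omega⟩, ?_, rfl, ?_⟩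
    · refine monotone_nat_of_le_succ fun n => ?_
      cases n with
      | zero => exact (t ⟨min 0 K, by omega⟩).2
      | succ n =>
        refine ht (Fin.mk_le_mk.2 ?_)
        omega
    · intro k
      refine congrArg t (Fin.ext ?_)
      have := k.2
      simp only []
      omega

omit [MeasurableSpace Ω] in
lemma laplaceProcess_eq_stepSum {η : ℝ} {P : Ici η → Ω → ℕ} (X : ℕ → Ω → ℝ) {ω : Ω}
    (hω : Monotone fun t => P t ω) {x : ℕ → Ici η} (hx : Monotone x) (h0 : P (x 0) ω = 0)
    {K : ℕ} (k : Fin K) :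
    laplaceProcess P X (x (k + 1)) ω = stepSum (fun i : Fin K => incr P X x i ω) k.succ := by
  have hstep : ∀ j : ℕ, laplaceProcess P X (x (j + 1)) ω =
      (if j = 0 then 0 else laplaceProcess P X (x j) ω) + incr P X x j ω := by
    intro j
    have hle : P (x j) ω ≤ P (x (j + 1)) ω := hω (hx (Nat.le_succ j))
    have h1 : laplaceProcess P X (x (j + 1)) ω = laplaceProcess P X (x j) ω +
        ∑ n ∈ Finset.Ioc (P (x j) ω) (P (x (j + 1)) ω), X n ω := by
      simp only [laplaceProcess, Finset.range_eq_Ico]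
      rw [← Finset.sum_Ico_consecutive _ (Nat.zero_le _) (Nat.succ_le_succ hle)]
      congr 2
      ext n
      simp only [Finset.mem_Ico, Finset.mem_Ioc]
      omega
    rw [h1, incr]
    split_ifs with hj
    · subst hj
      rw [zero_add, laplaceProcess, h0]
      simp
    · ring
  have key : ∀ k : Fin (K + 1), k ≠ 0 → laplaceProcess P X (x k) ω =
      stepSum (fun i : Fin K => incr P X x i ω) k := by
    intro k
    induction k using Fin.induction with
    | zero => exact fun h => absurd rfl h
    | succ k ih =>
      intro _
      rw [stepSum_succ, Fin.val_succ, hstep]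
      congr 1
      split_ifs with hk
      · have : k.castSucc = 0 := Fin.ext hk
        rw [this]
        simp [stepSum]
      · exact ih fun h => hk (congrArg Fin.val h)
  exact key k.succ (Fin.succ_ne_zero k)

/-- The finite-dimensional laws of a single Laplace process. -/
lemma hasLaw_laplaceProcess_fin {μ : Measure Ω} [IsProbabilityMeasure μ] {η : ℝ} (hη : 0 < η)
    {P : Ici η → Ω → ℕ} (hP : IsPoissonProcess μ η (fun t => 2 / t) P)
    {X : ℕ → Ω → ℝ} (hX : IsLaplaceJumps μ P X) {K : ℕ} {t : Fin K → Ici η} (ht : Monotone t) :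
    HasLaw (fun ω k => laplaceProcess P X (t k) ω) (discreteLaplaceLaw fun k => (t k : ℝ)) μ := by
  obtain ⟨x, hx, hx0, hxt⟩ := exists_sequence_of_fin ht
  have hx0' : x 0 = ⟨η, self_mem_Ici⟩ := Subtype.ext hx0
  have hpos : ∀ j, 0 < (x j : ℝ) := fun j => hη.trans_le (x j).2
  have h := hasLaw_incr hη hP hX hx hx0 K
  simp only [hxt] at h
  have hm : Measurable fun (y : Fin K → ℝ) (k : Fin K) => stepSum y k.succ :=
    measurable_pi_lambda _ fun k => measurable_stepSum _
  have h2 := HasLaw.comp ⟨hm.aemeasurable, rfl⟩ h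
  rw [← discreteLaplaceLaw_eq_map (fun k : Fin K => stepStart x k) (fun k => (t k : ℝ))] at h2
  · refine h2.congr ?_
    filter_upwards [hP.mono, hP.start] with ω hω h0
    funext k
    rw [← hxt k]
    exact laplaceProcess_eq_stepSum X hω hx (hx0' ▸ h0) k
  · intro k
    rcases K with _ | K
    · exact k.elim0
    · refine Fin.cases ?_ (fun j => ?_) k
      · simp [stepStart]
      · rw [← Fin.succ_castSucc, Fin.cons_succ, ← hxt]
        simp [stepStart]
  · intro k
    unfold stepStart; split_ifs; exacts [le_rfl, (hpos _).le]
  · intro k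
    unfold stepStart
    split_ifs
    · exact (hη.trans_le (t k).2).le
    · rw [← hxt]
      exact hx (Nat.le_succ _)
  · exact fun k => hη.trans_le (t k).2

lemma discreteLaplaceLaw_map_eval_one {t : ℝ} (ht : 0 < t) :
    (discreteLaplaceLaw fun _ : Fin 1 => t).map (fun y => y 0) = laplaceMeasure t := by
  have := isProbabilityMeasure_incrLaw le_rfl ht.le ht
  have := isProbabilityMeasure_laplaceMeasure ht
  rw [discreteLaplaceLaw_eq_map (fun _ => 0) _ (fun k => by simp [Subsingleton.elim k 0])
    (fun _ => le_rfl) (fun _ => ht.le) (fun _ => ht),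
    Measure.map_map (measurable_pi_apply 0) (measurable_pi_lambda _ fun k => measurable_stepSum _)]
  have e : ((fun y : Fin 1 → ℝ => y 0) ∘ fun (y : Fin 1 → ℝ) (k : Fin 1) => stepSum y k.succ) =
      Function.eval 0 := by
    funext y
    simp [stepSum_succ]
    simp [stepSum]
  rw [e, (measurePreserving_eval (fun _ : Fin 1 => incrLaw 0 t) 0).map_eq]
  refine Measure.ext_of_charFun (funext fun v => ?_)
  rw [charFun_incrLaw le_rfl ht.le ht, charFun_laplaceMeasure ht]
  simp [lapFactor]

lemma hasLaw_laplaceProcess {μ : Measure Ω} [IsProbabilityMeasure μ] {η : ℝ} (hη : 0 < η)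
    {P : Ici η → Ω → ℕ} (hP : IsPoissonProcess μ η (fun t => 2 / t) P)
    {X : ℕ → Ω → ℝ} (hX : IsLaplaceJumps μ P X) (t : Ici η) :
    HasLaw (laplaceProcess P X t) (laplaceMeasure t) μ :=
  HasLaw.fun_comp (Y := fun y : Fin 1 → ℝ => y 0)
    ⟨(measurable_pi_apply 0).aemeasurable, discreteLaplaceLaw_map_eval_one (hη.trans_le t.2)⟩
    (hasLaw_laplaceProcess_fin hη hP hX (t := fun _ : Fin 1 => t) monotone_const)

/-- The Laplace process as a function of the paths of the Poisson process and the jumps. -/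
noncomputable def pathFunctional {η : ℝ} (t : Ici η) (z : (Ici η → ℕ) × (ℕ → ℝ)) : ℝ :=
  ∑ n ∈ Finset.range (z.1 t + 1), z.2 n

lemma measurable_pathFunctional {η : ℝ} (t : Ici η) : Measurable (pathFunctional t) :=
  measurable_comp_of_countable (Y := fun z : (Ici η → ℕ) × (ℕ → ℝ) => z.1 t)
    ((measurable_pi_apply t).comp measurable_fst)
    (F := fun m z => ∑ n ∈ Finset.range (m + 1), z.2 n)
    fun _ => Finset.measurable_fun_sum _ fun n _ => (measurable_pi_apply n).comp measurable_snd

end LaplaceNoise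

theorem mainTheorem7 {Ω : Type*} [MeasurableSpace Ω] (μ : Measure Ω) [IsProbabilityMeasure μ]
    (η : ℝ) (hη : 0 < η) (d : ℕ)
    (P : Fin d → Ici η → Ω → ℕ) (X : Fin d → ℕ → Ω → ℝ)
    (hP : ∀ j, LaplaceNoise.IsPoissonProcess μ η (fun t => 2 / t) (P j))
    (hX : ∀ j, LaplaceNoise.IsLaplaceJumps μ (P j) (X j))
    (hind : iIndepFun (fun j ω => ((fun t => P j t ω), (fun n => X j n ω))) μ) :
    (∀ (j : Fin d) (t : Ici η),
      HasLaw (LaplaceNoise.laplaceProcess (P j) (X j) t) (LaplaceNoise.laplaceMeasure t) μ) ∧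
    (∀ t : Ici η,
      HasLaw (fun ω j => LaplaceNoise.laplaceProcess (P j) (X j) t ω)
        (Measure.pi fun _ : Fin d => LaplaceNoise.laplaceMeasure t) μ) ∧
    (∀ (K : ℕ) (t : Fin K → Ici η), Monotone t →
      HasLaw (fun ω j k => LaplaceNoise.laplaceProcess (P j) (X j) (t k) ω)
        (Measure.pi fun _ : Fin d => LaplaceNoise.discreteLaplaceLaw fun k => (t k : ℝ)) μ) := by
  have h1 := fun j t => LaplaceNoise.hasLaw_laplaceProcess hη (hP j) (hX j) t
  refine ⟨h1, fun t => ?_, fun K t ht => ?_⟩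
  · exact (hind.comp (fun _ => LaplaceNoise.pathFunctional t)
      fun _ => LaplaceNoise.measurable_pathFunctional t).hasLaw_pi fun j => h1 j t
  · exact (hind.comp (fun _ z k => LaplaceNoise.pathFunctional (t k) z) fun _ =>
      measurable_pi_lambda _ fun k => LaplaceNoise.measurable_pathFunctional (t k)).hasLaw_pi
        fun j => LaplaceNoise.hasLaw_laplaceProcess_fin hη (hP j) (hX j) ht
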